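/- A full binary tree is a finite rooted tree in which every vertex has either zero or two children. For integers $p\ge 1$, $q\ge 2$, the $(p,q)$ ornamented $T$ is the simple graph obtained from a full binary tree $T$ as follows: for every vertex $v$ of $T$ with two children $v_+,v_-$, add $p-1$ new vertices $a_1,\dots,a_{p-1}$ and $q-2$ new vertices $b_1,\dots,b_{q-2}$, and form the complete bipartite graph $K_{p,q}$ with parts $\{v,a_1,\dots,a_{p-1}\}$ and $\{v_+,v_-,b_1,\dots,b_{q-2}\}$ (the new vertices belonging to different $v$ being distinct). For a finite graph with adjacency matrix $A$ and diagonal degree matrix $D$, the normalized adjacency matrix is $\mathcal{A}=D^{-1/2}AD^{-1/2}$ (with the convention $0^{-1/2}=0$, relevant only when $T$ is a single vertex). Theorem. Let $T$ be a full binary tree, and let $p,p'\ge 1$ and $q,q'\ge 2$ be integers with $p+q=p'+q'$. Then the $(p,q)$ ornamented $T$ and the $(p',q')$ ornamented $T$ are cospectral for the normalized adjacency matrix, i.e. their matrices $\mathcal{A}$ have the same eigenvalues with the same multiplicities (equivalently, the same characteristic polynomial). -/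

import Mathlib

/-- The children of `v` in the graph `T` rooted at `r`: the neighbours of `v` that are one step
further from the root. -/
def childrenOf {V : Type*} (T : SimpleGraph V) (r v : V) : Set V :=
  {w | T.Adj v w ∧ T.dist r w = T.dist r v + 1}

/-- `T`, rooted at `r`, is a full binary tree: a tree in which every vertex has either zero or
two children. -/
structure IsFullBinaryTree {V : Type*} (T : SimpleGraph V) (r : V) : Prop where
  isTree : T.IsTree
  children_card : ∀ v, (childrenOf T r v).ncard = 0 ∨ (childrenOf T r v).ncard = 2

/-- The vertices with exactly two children. -/
abbrev Internal {V : Type*} (T : SimpleGraph V) (r : V) : Type _ :=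
  {v : V // (childrenOf T r v).ncard = 2}

/-- The vertices of the `(p, q)` ornamented tree: those of `T`, together with `p - 1` and `q - 2`
new vertices for each vertex of `T` with two children. -/
abbrev OrnVertex {V : Type*} (T : SimpleGraph V) (r : V) (p q : ℕ) : Type _ :=
  V ⊕ (Internal T r × (Fin (p - 1) ⊕ Fin (q - 2)))

/-- The part of size `p` of the block at `b`: the vertex `b` and `p - 1` new vertices. -/
def blockTop {V : Type*} (T : SimpleGraph V) (r : V) (p q : ℕ) (b : Internal T r) :
    Set (OrnVertex T r p q) :=
  {Sum.inl b.1} ∪ Set.range fun i : Fin (p - 1) => Sum.inr (b, Sum.inl i)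

/-- The part of size `q` of the block at `b`: the two children of `b` and `q - 2` new vertices. -/
def blockBot {V : Type*} (T : SimpleGraph V) (r : V) (p q : ℕ) (b : Internal T r) :
    Set (OrnVertex T r p q) :=
  (Sum.inl '' childrenOf T r b.1) ∪ Set.range fun j : Fin (q - 2) => Sum.inr (b, Sum.inr j)

/-- The `(p, q)` ornamented `T`: the union, over all vertices `b` with two children, of the
complete bipartite graphs with parts `blockTop b` and `blockBot b`. -/
def ornamented {V : Type*} (T : SimpleGraph V) (r : V) (p q : ℕ) :
    SimpleGraph (OrnVertex T r p q) where
  Adj x y := ∃ b : Internal T r,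
    (x ∈ blockTop T r p q b ∧ y ∈ blockBot T r p q b) ∨
      (x ∈ blockBot T r p q b ∧ y ∈ blockTop T r p q b)
  symm := ⟨by
    rintro x y ⟨b, h | h⟩
    · exact ⟨b, Or.inr ⟨h.2, h.1⟩⟩
    · exact ⟨b, Or.inl ⟨h.2, h.1⟩⟩⟩
  loopless := ⟨by
    have key : ∀ (b : Internal T r) (x : OrnVertex T r p q),
        x ∈ blockTop T r p q b → x ∈ blockBot T r p q b → False := by
      rintro b x (rfl | ⟨i, rfl⟩) (⟨w, hw, h⟩ | ⟨j, h⟩)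
      · cases h
        exact hw.1.ne rfl
      · cases h
      · cases h
      · simp at h
    rintro x ⟨b, h | h⟩
    · exact key b x h.1 h.2
    · exact key b x h.2 h.1⟩

open Classical in
/-- The normalized adjacency matrix `D ^ (-1/2) * A * D ^ (-1/2)`. -/
noncomputable def normalizedAdjacency {W : Type*} [Fintype W] (G : SimpleGraph W) :
    Matrix W W ℝ :=
  Matrix.diagonal (fun v => (G.degree v : ℝ) ^ (-(1 / 2) : ℝ)) * G.adjMatrix ℝ *
    Matrix.diagonal (fun v => (G.degree v : ℝ) ^ (-(1 / 2) : ℝ))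

open Classical in
/-- Two finite graphs are cospectral for the normalized adjacency matrix: the eigenvalues agree
with multiplicities, that is, the characteristic polynomials are equal. -/
def NormalizedCospectral {W W' : Type*} [Fintype W] [Fintype W']
    (G : SimpleGraph W) (H : SimpleGraph W') : Prop :=
  (normalizedAdjacency G).charpoly = (normalizedAdjacency H).charpoly

/-!
Let `t_b` and `u_b` be the indicator vectors of the two parts of the block at `b`. The adjacency
matrix of the ornamented tree is `A = ∑ b, (t_b u_bᵀ + u_b t_bᵀ)` (`adjMatrix_ornamented`), that is,
`A = [t u] [u t]ᵀ` with `t`, `u` the vertex-block incidence matrices. Since `M N` and `N M` have the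
same characteristic polynomial up to a power of `X`, the normalized adjacency matrix
`D^(-1/2) A D^(-1/2)` can be replaced by the matrix `[u t]ᵀ D⁻¹ [t u]`, whose rows and columns are
indexed by two copies of the set of blocks.

The degrees are `q` for the root, `p` for the leaves and `p + q` for the other vertices of `T`, and
`q` and `p` for the new vertices on top and at the bottom. Hence, with `s = p + q`,

* `u_bᵀ D⁻¹ t_c` is `1 / s` if `c` is a child of `b`, and `0` otherwise;
* `t_bᵀ D⁻¹ t_b = (p / q) (1 - ε / s)` with `ε = 0` if `b` is the root and `ε = 1` otherwise;
* `u_bᵀ D⁻¹ u_b = (q / p) (1 - j / s)` with `j` the number of internal children of `b`;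

and all the other products are zero. The matrix therefore depends on `p` and `q` beyond `s` only by
factors `q / p` and `p / q` on its two off-diagonal blocks, which a conjugation removes
(`charpoly_fromBlocks_smul`). The number of vertices, too, depends only on `T` and `s`, so the powers
of `X` agree (`X_pow_mul_charpoly_normalizedAdjacency`).
-/

open Matrix Polynomial

/-! ### Parents in a full binary tree -/

section Tree

variable {V : Type*} {T : SimpleGraph V} {r : V}

theorem IsFullBinaryTree.eq_of_mem_childrenOf (hT : IsFullBinaryTree T r) {u v w : V}
    (hu : w ∈ childrenOf T r u) (hv : w ∈ childrenOf T r v) : u = v := by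
  obtain ⟨p, hp⟩ := hT.isTree.connected.exists_walk_length_eq_dist r u
  obtain ⟨q, hq⟩ := hT.isTree.connected.exists_walk_length_eq_dist r v
  have hp' : (p.concat hu.1).IsPath := by
    apply SimpleGraph.Walk.isPath_of_length_eq_dist
    rw [SimpleGraph.Walk.length_concat, hp, hu.2]
  have hq' : (q.concat hv.1).IsPath := by
    apply SimpleGraph.Walk.isPath_of_length_eq_dist
    rw [SimpleGraph.Walk.length_concat, hq, hv.2]
  have h := (hT.isTree.existsUnique_path r w).unique hp' hq'
  exact (SimpleGraph.Walk.concat_inj h).1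

theorem IsFullBinaryTree.exists_mem_childrenOf (hT : IsFullBinaryTree T r) {v : V} (hv : v ≠ r) :
    ∃ u, v ∈ childrenOf T r u := by
  obtain ⟨p, hp⟩ := hT.isTree.connected.exists_walk_length_eq_dist r v
  have hn : ¬ p.Nil := SimpleGraph.Walk.not_nil_of_ne hv.symm
  refine ⟨p.penultimate, p.adj_penultimate hn, ?_⟩
  have h1 := SimpleGraph.dist_le p.dropLast
  have h2 : p.dropLast.length = p.length - 1 := by simp
  rcases hT.isTree.dist_eq_dist_add_one_of_adj r (p.adj_penultimate hn) with h | h <;> omega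

theorem root_notMem_childrenOf (v : V) : r ∉ childrenOf T r v := by
  rintro ⟨-, h⟩
  simp at h

theorem IsFullBinaryTree.ncard_childrenOf_eq_two [Finite V] (hT : IsFullBinaryTree T r) {v w : V}
    (h : w ∈ childrenOf T r v) : (childrenOf T r v).ncard = 2 := by
  refine (hT.children_card v).resolve_left fun h0 => ?_
  rw [Set.ncard_eq_zero] at h0
  simp [h0] at h

end Tree

/-! ### Membership in the parts of the blocks -/

section Parts

variable {V : Type*} {T : SimpleGraph V} {r : V} {p q : ℕ}

@[simp]
theorem inl_mem_blockTop {v : V} {b : Internal T r} :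
    (Sum.inl v : OrnVertex T r p q) ∈ blockTop T r p q b ↔ b.1 = v := by
  simp [blockTop, eq_comm]

@[simp]
theorem inr_inl_mem_blockTop {b c : Internal T r} {i : Fin (p - 1)} :
    (Sum.inr (c, Sum.inl i) : OrnVertex T r p q) ∈ blockTop T r p q b ↔ b = c := by
  simp [blockTop]

@[simp]
theorem inr_inr_notMem_blockTop {b c : Internal T r} {j : Fin (q - 2)} :
    (Sum.inr (c, Sum.inr j) : OrnVertex T r p q) ∉ blockTop T r p q b := by
  simp [blockTop]

@[simp]
theorem inl_mem_blockBot {v : V} {b : Internal T r} :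
    (Sum.inl v : OrnVertex T r p q) ∈ blockBot T r p q b ↔ v ∈ childrenOf T r b.1 := by
  simp [blockBot]

@[simp]
theorem inr_inl_notMem_blockBot {b c : Internal T r} {i : Fin (p - 1)} :
    (Sum.inr (c, Sum.inl i) : OrnVertex T r p q) ∉ blockBot T r p q b := by
  simp [blockBot]

@[simp]
theorem inr_inr_mem_blockBot {b c : Internal T r} {j : Fin (q - 2)} :
    (Sum.inr (c, Sum.inr j) : OrnVertex T r p q) ∈ blockBot T r p q b ↔ b = c := by
  simp [blockBot]

theorem eq_of_mem_blockTop {b c : Internal T r} {x : OrnVertex T r p q}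
    (hb : x ∈ blockTop T r p q b) (hc : x ∈ blockTop T r p q c) : b = c := by
  rcases x with v | ⟨d, i | j⟩ <;> simp_all [Subtype.ext_iff]

theorem IsFullBinaryTree.eq_of_mem_blockBot (hT : IsFullBinaryTree T r) {b c : Internal T r}
    {x : OrnVertex T r p q} (hb : x ∈ blockBot T r p q b) (hc : x ∈ blockBot T r p q c) :
    b = c := by
  rcases x with v | ⟨d, i | j⟩
  · exact Subtype.ext (hT.eq_of_mem_childrenOf (inl_mem_blockBot.1 hb) (inl_mem_blockBot.1 hc))
  · simp at hb
  · simp_all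

/-- An edge of the ornamented tree has only one orientation from a top part to a bottom part: two
vertices of `T` are not children of each other. -/
theorem not_mem_blockTop_blockBot_and_reversed {b c : Internal T r} {x y : OrnVertex T r p q}
    (hx : x ∈ blockTop T r p q b) (hy : y ∈ blockBot T r p q b)
    (hx' : x ∈ blockBot T r p q c) (hy' : y ∈ blockTop T r p q c) : False := by
  rcases x with v | ⟨d, i | j⟩
  · rcases y with w | ⟨e, i | j⟩
    · simp only [inl_mem_blockTop, inl_mem_blockBot] at *
      subst hx hy'
      have h1 := hx'.2
      have h2 := hy.2
      omega
    · simp at hy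
    · simp at hy'
  · simp at hx'
  · simp at hx

end Parts

/-- The definition, with arbitrary decidability instances in place of the classical ones. -/
theorem normalizedAdjacency_eq {W : Type*} [Fintype W] [DecidableEq W] (G : SimpleGraph W)
    [DecidableRel G.Adj] :
    normalizedAdjacency G =
      diagonal (fun v => (G.degree v : ℝ) ^ (-(1 / 2) : ℝ)) * G.adjMatrix ℝ *
        diagonal (fun v => (G.degree v : ℝ) ^ (-(1 / 2) : ℝ)) := by
  unfold normalizedAdjacency
  congr!

/-! ### Incidence matrices and degrees -/

noncomputable section Incidence

open Classical

variable {V : Type*} [Fintype V] (T : SimpleGraph V) (r : V) (p q : ℕ)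

/-- The vertex-block incidence matrix of the top parts: the column of `b` is the indicator vector
of `blockTop b`. -/
def topMatrix : Matrix (OrnVertex T r p q) (Internal T r) ℝ :=
  Matrix.of fun x b => if x ∈ blockTop T r p q b then 1 else 0

/-- The vertex-block incidence matrix of the bottom parts: the column of `b` is the indicator
vector of `blockBot b`. -/
def botMatrix : Matrix (OrnVertex T r p q) (Internal T r) ℝ :=
  Matrix.of fun x b => if x ∈ blockBot T r p q b then 1 else 0

/-- The matrix of the child relation between internal vertices: the `(b, c)` entry is `1` if `c` is
a child of `b`, and `0` otherwise. -/
def childMatrix : Matrix (Internal T r) (Internal T r) ℝ :=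
  Matrix.of fun b c => if c.1 ∈ childrenOf T r b.1 then 1 else 0

/-- The matrix that carries the spectrum of the ornamented tree, with `s` standing for `p + q`. Its
index set consists of two copies of the set of blocks, and its entries involve `p` and `q` only
through `s`. -/
def blockMatrix (s : ℝ) : Matrix (Internal T r ⊕ Internal T r) (Internal T r ⊕ Internal T r) ℝ :=
  fromBlocks (s⁻¹ • childMatrix T r)
    (diagonal fun b => 1 - s⁻¹ * ∑ c, childMatrix T r b c)
    (diagonal fun b => 1 - if b.1 = r then 0 else s⁻¹)
    (s⁻¹ • (childMatrix T r)ᵀ)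

variable {T r p q}

/-- The adjacency matrix is the sum over the blocks of the adjacency matrices of complete bipartite
graphs. There is no overcounting, because an edge lies in one block only. -/
theorem adjMatrix_ornamented :
    (ornamented T r p q).adjMatrix ℝ =
      topMatrix T r p q * (botMatrix T r p q)ᵀ + botMatrix T r p q * (topMatrix T r p q)ᵀ := by
  ext x y
  simp only [SimpleGraph.adjMatrix_apply, Matrix.add_apply, Matrix.mul_apply, topMatrix, botMatrix,
    Matrix.transpose_apply, Matrix.of_apply, ← ite_and, mul_ite, mul_one, mul_zero]
  by_cases h : (ornamented T r p q).Adj x y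
  · rw [if_pos h]
    obtain ⟨b, ⟨hx, hy⟩ | ⟨hx, hy⟩⟩ := h
    · rw [Finset.sum_eq_single b, Finset.sum_eq_zero, if_pos ⟨hy, hx⟩, add_zero]
      · intro c _
        exact if_neg fun h => not_mem_blockTop_blockBot_and_reversed hx hy h.2 h.1
      · intro c _ hc
        exact if_neg fun h => hc (eq_of_mem_blockTop h.2 hx)
      · simp
    · rw [Finset.sum_eq_zero, Finset.sum_eq_single b, if_pos ⟨hy, hx⟩, zero_add]
      · intro c _ hc
        exact if_neg fun h => hc (eq_of_mem_blockTop h.1 hy)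
      · simp
      · intro c _
        exact if_neg fun h => not_mem_blockTop_blockBot_and_reversed h.2 h.1 hx hy
  · rw [if_neg h, Finset.sum_eq_zero, Finset.sum_eq_zero, add_zero]
    · intro b _
      exact if_neg fun h' => h ⟨b, Or.inr ⟨h'.2, h'.1⟩⟩
    · intro b _
      exact if_neg fun h' => h ⟨b, Or.inl ⟨h'.2, h'.1⟩⟩

theorem sum_mem_childrenOf (b : Internal T r) :
    ∑ v, (if v ∈ childrenOf T r b.1 then (1 : ℝ) else 0) = 2 := by
  have h : (Finset.univ.filter fun v => v ∈ childrenOf T r b.1).card = 2 := by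
    rw [← Set.ncard_coe_finset, Finset.coe_filter_univ]
    exact b.2
  rw [Finset.sum_boole, h, Nat.cast_ofNat]

theorem sum_topMatrix (hp : 1 ≤ p) (b : Internal T r) : ∑ x, topMatrix T r p q x b = p := by
  simp [topMatrix, Fintype.sum_sum_type, Fintype.sum_prod_type, Nat.cast_sub hp,
    -Finset.sum_boole]

theorem sum_botMatrix (hq : 2 ≤ q) (b : Internal T r) : ∑ x, botMatrix T r p q x b = q := by
  simp [botMatrix, Fintype.sum_sum_type, Fintype.sum_prod_type, Nat.cast_sub hq,
    -Finset.sum_boole, sum_mem_childrenOf]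

/-- A vertex gains degree `q` from the block with it on top (if any) and degree `p` from the block
with it at the bottom (if any). -/
theorem degree_ornamented (hp : 1 ≤ p) (hq : 2 ≤ q)
    (x : OrnVertex T r p q) :
    ((ornamented T r p q).degree x : ℝ) =
      q * ∑ b, topMatrix T r p q x b + p * ∑ b, botMatrix T r p q x b := by
  have h : ((ornamented T r p q).degree x : ℝ) =
      ((ornamented T r p q).adjMatrix ℝ *ᵥ fun _ => 1) x := by
    simp [Matrix.mulVec, dotProduct, SimpleGraph.adjMatrix_apply,
      ← SimpleGraph.card_neighborFinset_eq_degree, SimpleGraph.neighborFinset_eq_filter]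
  rw [h, adjMatrix_ornamented, Matrix.add_mulVec, Pi.add_apply, ← Matrix.mulVec_mulVec,
    ← Matrix.mulVec_mulVec]
  have ht : (topMatrix T r p q)ᵀ *ᵥ (fun _ => 1) = fun _ => (p : ℝ) := by
    ext b
    simp [Matrix.mulVec, dotProduct, sum_topMatrix hp]
  have hb : (botMatrix T r p q)ᵀ *ᵥ (fun _ => 1) = fun _ => (q : ℝ) := by
    ext b
    simp [Matrix.mulVec, dotProduct, sum_botMatrix hq]
  rw [ht, hb]
  simp [Matrix.mulVec, dotProduct, ← Finset.sum_mul, mul_comm]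

theorem sum_topMatrix_inl (v : V) :
    ∑ b, topMatrix T r p q (Sum.inl v) b = if (childrenOf T r v).ncard = 2 then 1 else 0 := by
  simp only [topMatrix, Matrix.of_apply, inl_mem_blockTop]
  split_ifs with h
  · rw [Finset.sum_eq_single ⟨v, h⟩] <;> simp +contextual [Subtype.ext_iff]
  · exact Finset.sum_eq_zero fun b _ => if_neg fun hb : b.1 = v => h (hb ▸ b.2)

theorem IsFullBinaryTree.sum_botMatrix_inl (hT : IsFullBinaryTree T r) (v : V) :
    ∑ b, botMatrix T r p q (Sum.inl v) b = if v = r then 0 else 1 := by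
  simp only [botMatrix, Matrix.of_apply, inl_mem_blockBot]
  split_ifs with h
  · subst h
    exact Finset.sum_eq_zero fun b _ => if_neg (root_notMem_childrenOf _)
  · obtain ⟨u, hu⟩ := hT.exists_mem_childrenOf h
    rw [Finset.sum_eq_single ⟨u, hT.ncard_childrenOf_eq_two hu⟩, if_pos hu]
    · intro b _ hb
      exact if_neg fun hv => hb (Subtype.ext (hT.eq_of_mem_childrenOf hv hu))
    · simp

theorem degree_ornamented_inl (hT : IsFullBinaryTree T r) (hp : 1 ≤ p) (hq : 2 ≤ q) (v : V) :
    ((ornamented T r p q).degree (Sum.inl v) : ℝ) =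
      (if (childrenOf T r v).ncard = 2 then (q : ℝ) else 0) + if v = r then 0 else (p : ℝ) := by
  rw [degree_ornamented hp hq, sum_topMatrix_inl, hT.sum_botMatrix_inl]
  simp

theorem degree_ornamented_inr_inl (hp : 1 ≤ p) (hq : 2 ≤ q)
    (b : Internal T r) (i : Fin (p - 1)) :
    ((ornamented T r p q).degree (Sum.inr (b, Sum.inl i)) : ℝ) = q := by
  rw [degree_ornamented hp hq]
  simp [topMatrix, botMatrix]

theorem degree_ornamented_inr_inr (hp : 1 ≤ p) (hq : 2 ≤ q)
    (b : Internal T r) (j : Fin (q - 2)) :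
    ((ornamented T r p q).degree (Sum.inr (b, Sum.inr j)) : ℝ) = p := by
  rw [degree_ornamented hp hq]
  simp [topMatrix, botMatrix]

/-! ### Products of incidence matrices weighted by inverse degrees -/

variable (T r p q) in
/-- The diagonal matrix of inverse degrees; an isolated vertex gets the entry `0`. -/
def invDegreeMatrix : Matrix (OrnVertex T r p q) (OrnVertex T r p q) ℝ :=
  diagonal fun x => ((ornamented T r p q).degree x : ℝ)⁻¹

theorem transpose_mul_invDegreeMatrix_mul_apply {ι : Type*}
    (A B : Matrix (OrnVertex T r p q) ι ℝ) (b c : ι) :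
    (Aᵀ * invDegreeMatrix T r p q * B) b c =
      ∑ x, A x b * ((ornamented T r p q).degree x : ℝ)⁻¹ * B x c := by
  rw [Matrix.mul_apply]
  simp only [invDegreeMatrix, Matrix.mul_diagonal, transpose_apply]

/-- The parts `blockBot b` and `blockTop c` meet only if `c` is a child of `b`, and then exactly in
`c`, which has degree `p + q`. -/
theorem botMatrix_transpose_mul_topMatrix (hT : IsFullBinaryTree T r) (hp : 1 ≤ p) (hq : 2 ≤ q) :
    (botMatrix T r p q)ᵀ * invDegreeMatrix T r p q * topMatrix T r p q =
      ((p + q : ℕ) : ℝ)⁻¹ • childMatrix T r := by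
  ext b c
  rw [transpose_mul_invDegreeMatrix_mul_apply, Matrix.smul_apply,
    Finset.sum_eq_single (Sum.inl c.1)]
  · simp only [degree_ornamented_inl hT hp hq]
    by_cases h : c.1 ∈ childrenOf T r b.1
    · have hc : c.1 ≠ r := fun hc => root_notMem_childrenOf b.1 (hc ▸ h)
      simp [botMatrix, topMatrix, childMatrix, h, hc, c.2, add_comm]
    · simp [botMatrix, topMatrix, childMatrix, h]
  · rintro (v | ⟨d, i | j⟩) _ hx
    · have h : c.1 ≠ v := fun h => hx (h ▸ rfl)
      simp [topMatrix, h]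
    · simp [botMatrix]
    · simp [topMatrix]
  · simp

/-- The diagonal entry at `b` is `(p - 1) / q + 1 / deg b`, where `b` has degree `q` if it is the root
and `p + q` otherwise. -/
theorem topMatrix_transpose_mul_topMatrix (hT : IsFullBinaryTree T r) (hp : 1 ≤ p) (hq : 2 ≤ q) :
    (topMatrix T r p q)ᵀ * invDegreeMatrix T r p q * topMatrix T r p q =
      (p / q : ℝ) • diagonal fun b => 1 - if b.1 = r then 0 else ((p + q : ℕ) : ℝ)⁻¹ := by
  ext b c
  rw [transpose_mul_invDegreeMatrix_mul_apply, Matrix.smul_apply]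
  obtain rfl | hbc := eq_or_ne b c
  · simp only [Fintype.sum_sum_type, Fintype.sum_prod_type, diagonal_apply_eq]
    rw [Finset.sum_eq_single b.1, Finset.sum_eq_single b]
    · simp only [degree_ornamented_inl hT hp hq, degree_ornamented_inr_inl hp hq]
      have hq0 : (q : ℝ) ≠ 0 := by positivity
      have hs : (q : ℝ) + p ≠ 0 := by positivity
      by_cases h : b.1 = r
      · have h2 : (childrenOf T r r).ncard = 2 := by
          have hb := b.2
          rwa [h] at hb
        simp [topMatrix, h, h2, Nat.cast_sub hp]
        field_simp
        ring
      · simp [topMatrix, b.2, h, Nat.cast_sub hp, add_comm (p : ℝ)]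
        field_simp
        ring
    · intro d _ hd
      simp [topMatrix, hd.symm]
    · simp
    · intro v _ hv
      simp [topMatrix, hv.symm]
    · simp
  · rw [diagonal_apply_ne _ hbc, smul_zero]
    refine Finset.sum_eq_zero fun x _ => ?_
    by_cases hb : x ∈ blockTop T r p q b
    · have hc : x ∉ blockTop T r p q c := fun hc => hbc (eq_of_mem_blockTop hb hc)
      simp [topMatrix, hc]
    · simp [topMatrix, hb]

theorem sum_childMatrix (b : Internal T r) :
    ∑ c, childMatrix T r b c =
      ∑ v, if v ∈ childrenOf T r b.1 ∧ (childrenOf T r v).ncard = 2 then (1 : ℝ) else 0 := by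
  simp only [and_comm (a := _ ∈ childrenOf T r b.1), ite_and, childMatrix, Matrix.of_apply]
  have hmem : ∀ v, v ∈ Finset.univ.filter (fun v => (childrenOf T r v).ncard = 2) ↔
      (childrenOf T r v).ncard = 2 := by simp
  exact (Finset.sum_subtype _ hmem
    (fun v => if v ∈ childrenOf T r b.1 then (1 : ℝ) else 0)).symm.trans
      (Finset.sum_filter _ _)

/-- The diagonal entry at `b` is `(q - 2) / p` plus the inverse degrees of the two children, each of
which is `1 / p` for a leaf and `1 / (p + q)` for an internal vertex. -/
theorem botMatrix_transpose_mul_botMatrix (hT : IsFullBinaryTree T r) (hp : 1 ≤ p) (hq : 2 ≤ q) :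
    (botMatrix T r p q)ᵀ * invDegreeMatrix T r p q * botMatrix T r p q =
      (q / p : ℝ) • diagonal fun b => 1 - ((p + q : ℕ) : ℝ)⁻¹ * ∑ c, childMatrix T r b c := by
  ext b c
  rw [transpose_mul_invDegreeMatrix_mul_apply, Matrix.smul_apply]
  have hp0 : (p : ℝ) ≠ 0 := by positivity
  have hs : (q : ℝ) + p ≠ 0 := by positivity
  obtain rfl | hbc := eq_or_ne b c
  · simp only [Fintype.sum_sum_type, Fintype.sum_prod_type, diagonal_apply_eq]
    -- `1 / (p + q) = 1 / p - (q / p) * (1 / (p + q))`: an internal child differs from a leaf by a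
    -- multiple of the factor `q / p`
    have hv : ∀ v, botMatrix T r p q (Sum.inl v) b *
        ((ornamented T r p q).degree (Sum.inl v) : ℝ)⁻¹ * botMatrix T r p q (Sum.inl v) b =
        (p : ℝ)⁻¹ * (if v ∈ childrenOf T r b.1 then 1 else 0) -
          (q / p : ℝ) * ((p + q : ℕ) : ℝ)⁻¹ *
            if v ∈ childrenOf T r b.1 ∧ (childrenOf T r v).ncard = 2 then 1 else 0 := by
      intro v
      rw [degree_ornamented_inl hT hp hq]
      by_cases h : v ∈ childrenOf T r b.1
      · have hr : v ≠ r := fun hr => root_notMem_childrenOf b.1 (hr ▸ h)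
        by_cases h2 : (childrenOf T r v).ncard = 2
        · simp [botMatrix, h, hr, h2, add_comm (p : ℝ)]
          field_simp
          ring
        · simp [botMatrix, h, hr, h2]
      · simp [botMatrix, h]
    simp only [hv]
    rw [Finset.sum_sub_distrib, ← Finset.mul_sum, ← Finset.mul_sum, sum_mem_childrenOf,
      Finset.sum_eq_single b, ← sum_childMatrix]
    · simp only [degree_ornamented_inr_inr hp hq]
      simp [botMatrix, Nat.cast_sub hq]
      field_simp
      ring
    · intro d _ hd
      simp [botMatrix, hd.symm]
    · simp
  · rw [diagonal_apply_ne _ hbc, smul_zero]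
    refine Finset.sum_eq_zero fun x _ => ?_
    by_cases hb : x ∈ blockBot T r p q b
    · have hc : x ∉ blockBot T r p q c := fun hc => hbc (hT.eq_of_mem_blockBot hb hc)
      simp [botMatrix, hc]
    · simp [botMatrix, hb]

end Incidence

/-! ### Characteristic polynomials -/

/-- Scaling the off-diagonal blocks by `c` and `c⁻¹` is conjugation by a block diagonal matrix. -/
theorem charpoly_fromBlocks_smul {m n : Type*} [Fintype m] [Fintype n] [DecidableEq m]
    [DecidableEq n] (A : Matrix m m ℝ) (B : Matrix m n ℝ) (C : Matrix n m ℝ) (D : Matrix n n ℝ)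
    {c : ℝ} (hc : c ≠ 0) :
    (fromBlocks A (c • B) (c⁻¹ • C) D).charpoly = (fromBlocks A B C D).charpoly := by
  have h : fromBlocks A (c • B) (c⁻¹ • C) D =
      fromBlocks (c • 1) 0 0 1 * (fromBlocks A B C D * fromBlocks (c⁻¹ • 1) 0 0 1) := by
    simp [fromBlocks_multiply, smul_smul, hc]
  rw [h, charpoly_mul_comm, Matrix.mul_assoc]
  simp [fromBlocks_multiply, smul_smul, hc]

open Classical in
/-- Up to powers of `X` with exponents depending only on `T` and `p + q`, the characteristic
polynomial is that of `blockMatrix`. -/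
theorem X_pow_mul_charpoly_normalizedAdjacency {V : Type*} [Fintype V] {T : SimpleGraph V} {r : V}
    {p q : ℕ} (hT : IsFullBinaryTree T r) (hp : 1 ≤ p) (hq : 2 ≤ q) :
    (X : ℝ[X]) ^ Fintype.card (Internal T r ⊕ Internal T r) *
        (normalizedAdjacency (ornamented T r p q)).charpoly =
      X ^ Fintype.card (OrnVertex T r p q) * (blockMatrix T r ((p + q : ℕ) : ℝ)).charpoly := by
  set E : Matrix (OrnVertex T r p q) (OrnVertex T r p q) ℝ :=
    diagonal fun v => ((ornamented T r p q).degree v : ℝ) ^ (-(1 / 2) : ℝ) with hE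
  have hEE : E * E = invDegreeMatrix T r p q := by
    rw [hE, diagonal_mul_diagonal, invDegreeMatrix]
    congr 1
    ext x
    rw [Real.rpow_neg (Nat.cast_nonneg _), ← mul_inv, ← Real.sqrt_eq_rpow,
      Real.mul_self_sqrt (Nat.cast_nonneg _)]
  have hmul (A B : Matrix (OrnVertex T r p q) (Internal T r) ℝ) :
      Aᵀ * E * (E * B) = Aᵀ * invDegreeMatrix T r p q * B := by
    rw [← hEE]
    simp only [Matrix.mul_assoc]
  -- a factorization through the blocks; in the reversed product `E` occurs only as `E * E`
  have h : normalizedAdjacency (ornamented T r p q) =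
      fromCols (E * topMatrix T r p q) (E * botMatrix T r p q) *
        fromRows ((botMatrix T r p q)ᵀ * E) ((topMatrix T r p q)ᵀ * E) := by
    rw [fromCols_mul_fromRows, normalizedAdjacency_eq, ← hE, adjMatrix_ornamented]
    simp only [Matrix.mul_add, Matrix.add_mul, Matrix.mul_assoc]
  have hp0 : (p : ℝ) ≠ 0 := by positivity
  have hq0 : (q : ℝ) ≠ 0 := by positivity
  have htb : (topMatrix T r p q)ᵀ * invDegreeMatrix T r p q * botMatrix T r p q =
      ((p + q : ℕ) : ℝ)⁻¹ • (childMatrix T r)ᵀ := by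
    rw [← transpose_smul, ← botMatrix_transpose_mul_topMatrix hT hp hq]
    simp [invDegreeMatrix, Matrix.mul_assoc]
  rw [h, charpoly_mul_comm', fromRows_mul_fromCols, hmul, hmul, hmul, hmul,
    botMatrix_transpose_mul_topMatrix hT hp hq, botMatrix_transpose_mul_botMatrix hT hp hq,
    topMatrix_transpose_mul_topMatrix hT hp hq, htb, ← inv_div (q : ℝ) p,
    charpoly_fromBlocks_smul _ _ _ _ (div_ne_zero hq0 hp0), blockMatrix]

theorem theorem3 {V : Type*} [Fintype V] (T : SimpleGraph V) (r : V)
    (hT : IsFullBinaryTree T r) (p q p' q' : ℕ) (hp : 1 ≤ p) (hq : 2 ≤ q)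
    (hp' : 1 ≤ p') (hq' : 2 ≤ q') (hpq : p + q = p' + q') :
    NormalizedCospectral (ornamented T r p q) (ornamented T r p' q') := by
  classical
  have hcard : Fintype.card (OrnVertex T r p q) = Fintype.card (OrnVertex T r p' q') := by
    have : p - 1 + (q - 2) = p' - 1 + (q' - 2) := by omega
    simp [this]
  have h := X_pow_mul_charpoly_normalizedAdjacency hT hp hq
  rw [hpq, hcard, ← X_pow_mul_charpoly_normalizedAdjacency hT hp' hq'] at h
  have h' := (isRegular_X_pow _).left h
  unfold NormalizedCospectral
  convert h'
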